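/- Let $\mathbb D$ be the open unit disk, $\mathbb T$ the unit circle with normalized Lebesgue measure $dm(t)=\frac{1}{2\pi i}\frac{dt}{t}$, and let $C_A$ be the Banach space of all functions that are continuous on $\overline{\mathbb D}$ and analytic in $\mathbb D$, with the supremum norm. Let $\varphi:\mathbb D\to\mathbb D$ be analytic. Then for every $h\in C_A$ and every $\zeta\in\overline{\mathbb D}$ the limit $$P_\varphi h(\zeta)=\lim_{r\to1^-}\int_{\mathbb T}\frac{h(t)}{1-\zeta\,\overline{\varphi(rt)}}\,dm(t)$$ exists, the function $P_\varphi h$ belongs to $C_A$, and $P_\varphi$ is a bounded linear operator on $C_A$ whose operator norm satisfies $$\|P_\varphi\|\le\frac{1+2|\varphi(0)|}{1-|\varphi(0)|}.$$ -/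

import Mathlib

open scoped ComplexConjugate Topology

/-- The closed unit disk of the complex plane. -/
abbrev ClosedUnitDisk : Set ℂ := Metric.closedBall (0 : ℂ) 1

/-- A function on the closed unit disk, extended by `0` to the whole plane. Only its values on the
closed disk are ever used. -/
noncomputable def zeroExtend (f : ClosedUnitDisk → ℂ) : ℂ → ℂ :=
  Function.extend Subtype.val f 0

theorem zeroExtend_of_mem (f : ClosedUnitDisk → ℂ) {z : ℂ} (hz : z ∈ ClosedUnitDisk) :
    zeroExtend f z = f ⟨z, hz⟩ :=
  Subtype.val_injective.extend_apply f 0 ⟨z, hz⟩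

/-- The disk algebra `C_A`: the continuous functions on the closed unit disk that are analytic in
the open unit disk. As a subspace of `C(ClosedUnitDisk, ℂ)` it carries the supremum norm. -/
noncomputable def DiskAlgebra : Submodule ℂ C(ClosedUnitDisk, ℂ) where
  carrier := {f | AnalyticOnNhd ℂ (zeroExtend f) (Metric.ball 0 1)}
  zero_mem' := by
    refine (analyticOnNhd_const (v := (0 : ℂ))).congr Metric.isOpen_ball fun z hz => ?_
    rw [zeroExtend_of_mem _ (Metric.ball_subset_closedBall hz)]
    rfl
  add_mem' := by
    intro f g hf hg
    refine (AnalyticOnNhd.add hf hg).congr Metric.isOpen_ball fun z hz => ?_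
    have hz' := Metric.ball_subset_closedBall hz
    simp [zeroExtend_of_mem _ hz']
  smul_mem' := by
    intro c f hf
    refine ((analyticOnNhd_const (v := c)).mul hf).congr Metric.isOpen_ball fun z hz => ?_
    have hz' := Metric.ball_subset_closedBall hz
    simp [zeroExtend_of_mem _ hz']

/-- The integral `∫_𝕋 h(t) / (1 - ζ * conj (φ (r t))) dm(t)`, where `m` is normalized Lebesgue
measure on the unit circle `𝕋`. -/
noncomputable def cauchyKernelIntegral (φ : ℂ → ℂ) (h : DiskAlgebra) (r : ℝ) (ζ : ℂ) : ℂ :=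
  Real.circleAverage
    (fun t : ℂ => zeroExtend (h : C(ClosedUnitDisk, ℂ)) t / (1 - ζ * conj (φ ((r : ℂ) * t)))) 0 1

open Metric Set Filter

/-! For `‖ζ‖ = 1` put `G z = 1 / (1 - conj ζ * φ (r z))`. The kernel on the circle is `conj G = (2
Re G - 1) - (G - 1)`. The first term is nonnegative and harmonic, so against `g` it contributes at
most `sup |g|` times its value at `0`; the second is analytic, so the mean value property gives
exactly `g 0 * (G 0 - 1)`. With `a = ‖φ 0‖` the total is at most `2 / (1 - a) - 1 + a / (1 - a) = (1
+ 2 a) / (1 - a)` times `sup |g|`, uniformly in `r` (`norm_dilatedCauchyAverage_le`).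

Convergence as `r → 1` follows from the same bound: by a contour shift
(`dilatedCauchyAverage_mul_eq`), replacing `r` by `r s` amounts to replacing `g` by `g (s ·)`, which
is uniformly close to `g` for `s` near `1`. The averages are thus uniformly Cauchy on the closed
disk, and their limit lies in the disk algebra. -/

/-- The circle average of `g t / (1 - ζ * conj (φ (r t)))` over the unit circle. -/
noncomputable def dilatedCauchyAverage (φ g : ℂ → ℂ) (r : ℝ) (ζ : ℂ) : ℂ :=
  Real.circleAverage (fun t : ℂ => g t / (1 - ζ * conj (φ ((r : ℂ) * t)))) 0 1

/-! ### Elementary estimates on the disk. -/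

theorem one_sub_ne_zero_of_norm_lt_one {b : ℂ} (hb : ‖b‖ < 1) : 1 - b ≠ 0 := by
  intro h
  rw [← sub_eq_zero.1 h] at hb
  simp at hb

theorem norm_mul_lt_one_of_le_of_lt {ζ w : ℂ} (hζ : ‖ζ‖ ≤ 1) (hw : ‖w‖ < 1) : ‖ζ * w‖ < 1 := by
  rw [norm_mul]
  nlinarith [norm_nonneg ζ, norm_nonneg w]

/-- Equivalent to `Re ((1 + b) / (1 - b)) ≥ 0`; this is the source of positivity in the norm bound.
-/
theorem half_le_re_inv_one_sub {b : ℂ} (hb : ‖b‖ < 1) : 1 / 2 ≤ ((1 - b)⁻¹).re := by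
  have h0 : 0 < Complex.normSq (1 - b) :=
    Complex.normSq_pos.2 (one_sub_ne_zero_of_norm_lt_one hb)
  have hb' : Complex.normSq b < 1 := by
    rw [Complex.normSq_eq_norm_sq]
    nlinarith [norm_nonneg b]
  rw [Complex.inv_re, div_le_div_iff₀ two_pos h0]
  simp only [Complex.normSq_apply, Complex.sub_re, Complex.sub_im, Complex.one_re,
    Complex.one_im] at *
  nlinarith

theorem mapsTo_real_mul_closedBall {r : ℝ} (hr0 : 0 ≤ r) (hr1 : r < 1) :
    MapsTo (fun z : ℂ => (r : ℂ) * z) (closedBall 0 1) (ball 0 1) := by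
  intro z hz
  simp only [mem_closedBall_zero_iff, mem_ball_zero_iff, norm_mul, Complex.norm_real,
    Real.norm_of_nonneg hr0] at *
  nlinarith

theorem mapsTo_real_mul_closedBall_self {s : ℝ} (hs0 : 0 ≤ s) (hs1 : s ≤ 1) :
    MapsTo (fun z : ℂ => (s : ℂ) * z) (closedBall 0 1) (closedBall 0 1) := by
  intro z hz
  simp only [mem_closedBall_zero_iff, norm_mul, Complex.norm_real, Real.norm_of_nonneg hs0] at *
  nlinarith

/-! ### Dilated self-maps and analyticity in `ζ`. -/

section SelfMap

variable {φ : ℂ → ℂ} {r : ℝ}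

theorem continuousOn_comp_real_mul (hφ : DifferentiableOn ℂ φ (ball 0 1)) (hr0 : 0 ≤ r)
    (hr1 : r < 1) : ContinuousOn (fun z : ℂ => φ (r * z)) (closedBall 0 1) :=
  hφ.continuousOn.comp (by fun_prop) (mapsTo_real_mul_closedBall hr0 hr1)

theorem diffContOnCl_comp_real_mul (hφ : DifferentiableOn ℂ φ (ball 0 1)) (hr0 : 0 ≤ r)
    (hr1 : r < 1) : DiffContOnCl ℂ (fun z : ℂ => φ (r * z)) (ball 0 1) :=
  DiffContOnCl.mk_ball
    (hφ.comp (by fun_prop) ((mapsTo_real_mul_closedBall hr0 hr1).mono_left ball_subset_closedBall))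
    (continuousOn_comp_real_mul hφ hr0 hr1)

theorem exists_norm_comp_real_mul_le (hφ : DifferentiableOn ℂ φ (ball 0 1))
    (hmaps : MapsTo φ (ball 0 1) (ball 0 1)) (hr0 : 0 ≤ r) (hr1 : r < 1) :
    ∃ ρ : ℝ, 0 ≤ ρ ∧ ρ < 1 ∧ ∀ z ∈ closedBall (0 : ℂ) 1, ‖φ (r * z)‖ ≤ ρ := by
  obtain ⟨x, hx, hmax⟩ := (isCompact_closedBall (0 : ℂ) 1).exists_isMaxOn ⟨0, by simp⟩
    (continuousOn_comp_real_mul hφ hr0 hr1).norm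
  exact ⟨‖φ (r * x)‖, norm_nonneg _,
    mem_ball_zero_iff.1 (hmaps (mapsTo_real_mul_closedBall hr0 hr1 hx)), fun z hz => hmax hz⟩

theorem norm_comp_real_mul_lt_one (hmaps : MapsTo φ (ball 0 1) (ball 0 1)) (hr0 : 0 ≤ r)
    (hr1 : r < 1) {z : ℂ} (hz : z ∈ closedBall (0 : ℂ) 1) : ‖φ (r * z)‖ < 1 :=
  mem_ball_zero_iff.1 (hmaps (mapsTo_real_mul_closedBall hr0 hr1 hz))

theorem circleIntegrable_dilatedCauchyKernel (hφ : DifferentiableOn ℂ φ (ball 0 1))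
    (hmaps : MapsTo φ (ball 0 1) (ball 0 1)) (hr0 : 0 ≤ r) (hr1 : r < 1) {g : ℂ → ℂ}
    (hg : ContinuousOn g (closedBall 0 1)) {ζ : ℂ} (hζ : ‖ζ‖ ≤ 1) :
    CircleIntegrable (fun t : ℂ => g t / (1 - ζ * conj (φ ((r : ℂ) * t)))) 0 1 := by
  refine ContinuousOn.circleIntegrable zero_le_one (ContinuousOn.mono ?_ sphere_subset_closedBall)
  refine hg.div (continuousOn_const.sub (continuousOn_const.mul
    (Complex.continuous_conj.comp_continuousOn (continuousOn_comp_real_mul hφ hr0 hr1))))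
    fun z hz => one_sub_ne_zero_of_norm_lt_one (norm_mul_lt_one_of_le_of_lt hζ ?_)
  simpa using norm_comp_real_mul_lt_one hmaps hr0 hr1 hz

theorem differentiableAt_dilatedCauchyAverage (hφ : DifferentiableOn ℂ φ (ball 0 1))
    (hmaps : MapsTo φ (ball 0 1) (ball 0 1)) (hr0 : 0 ≤ r) (hr1 : r < 1) {g : ℂ → ℂ}
    (hg : ContinuousOn g (closedBall 0 1)) {ζ : ℂ} (hζ : ‖ζ‖ ≤ 1) :
    DifferentiableAt ℂ (dilatedCauchyAverage φ g r) ζ := by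
  obtain ⟨ρ, hρ0, hρ1, hρ⟩ := exists_norm_comp_real_mul_le hφ hmaps hr0 hr1
  have hmem : ∀ θ, circleMap 0 1 θ ∈ closedBall (0 : ℂ) 1 := fun θ =>
    circleMap_mem_closedBall 0 zero_le_one θ
  have hac : Continuous fun θ => g (circleMap 0 1 θ) :=
    hg.comp_continuous (continuous_circleMap 0 1) hmem
  have hbc : Continuous fun θ => conj (φ (r * circleMap 0 1 θ)) :=
    Complex.continuous_conj.comp
      ((continuousOn_comp_real_mul hφ hr0 hr1).comp_continuous (continuous_circleMap 0 1) hmem)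
  have hbρ : ∀ θ, ‖conj (φ (r * circleMap 0 1 θ))‖ ≤ ρ := fun θ => by
    simpa using hρ _ (hmem θ)
  generalize ha : (fun θ => g (circleMap 0 1 θ)) = a at hac
  generalize hb : (fun θ => conj (φ (r * circleMap 0 1 θ))) = b at hbc
  replace hbρ : ∀ θ, ‖b θ‖ ≤ ρ := fun θ => hb ▸ hbρ θ
  -- The radius `2 / (1 + ρ)` exceeds `1` while its product with `ρ` stays below `1`, so the kernel
  -- is controlled on a neighbourhood of the closed disk.
  have hR : ∀ x ∈ ball (0 : ℂ) (2 / (1 + ρ)), ∀ θ,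
      1 - ρ * (2 / (1 + ρ)) ≤ ‖1 - x * b θ‖ := by
    intro x hx θ
    have h1 : ‖x * b θ‖ ≤ 2 / (1 + ρ) * ρ := by
      rw [norm_mul]
      exact mul_le_mul (mem_ball_zero_iff.1 hx).le (hbρ θ) (norm_nonneg _) (by positivity)
    have h2 := norm_sub_norm_le (1 : ℂ) (x * b θ)
    rw [norm_one] at h2
    linarith
  have hpos : 0 < 1 - ρ * (2 / (1 + ρ)) := by
    rw [sub_pos, mul_div_assoc', div_lt_one (by positivity)]
    linarith
  have hne : ∀ x ∈ ball (0 : ℂ) (2 / (1 + ρ)), ∀ θ, 1 - x * b θ ≠ 0 := fun x hx θ =>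
    norm_pos_iff.1 (hpos.trans_le (hR x hx θ))
  have hζR : ζ ∈ ball (0 : ℂ) (2 / (1 + ρ)) := by
    rw [mem_ball_zero_iff]
    refine hζ.trans_lt ?_
    rw [lt_div_iff₀ (by positivity)]
    linarith
  have hcont : ∀ x ∈ ball (0 : ℂ) (2 / (1 + ρ)), Continuous fun θ => a θ / (1 - x * b θ) :=
    fun x hx => hac.div (by fun_prop) (hne x hx)
  have hcont' : Continuous fun θ => a θ * b θ / (1 - ζ * b θ) ^ 2 :=
    (hac.mul hbc).div (by fun_prop) fun θ => pow_ne_zero 2 (hne ζ hζR θ)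
  have key := (intervalIntegral.hasDerivAt_integral_of_dominated_loc_of_deriv_le
    (μ := MeasureTheory.volume) (a := 0) (b := 2 * Real.pi)
    (F := fun x θ => a θ / (1 - x * b θ)) (F' := fun x θ => a θ * b θ / (1 - x * b θ) ^ 2)
    (bound := fun θ => ‖a θ‖ * ρ / (1 - ρ * (2 / (1 + ρ))) ^ 2)
    (x₀ := ζ) (isOpen_ball.mem_nhds hζR)
    (Filter.eventually_of_mem (isOpen_ball.mem_nhds hζR)
      fun x hx => (hcont x hx).aestronglyMeasurable)
    ((hcont ζ hζR).intervalIntegrable _ _) hcont'.aestronglyMeasurable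
    (Eventually.of_forall fun θ _ x hx => ?_)
    (by apply Continuous.intervalIntegrable; fun_prop)
    (Eventually.of_forall fun θ _ x hx => ?_)).2
  · have heq : dilatedCauchyAverage φ g r =
        fun x => (2 * Real.pi)⁻¹ • ∫ θ in (0 : ℝ)..2 * Real.pi, a θ / (1 - x * b θ) := by
      subst ha hb
      rfl
    rw [heq]
    exact key.differentiableAt.const_smul (2 * Real.pi)⁻¹
  · rw [norm_div, norm_mul, norm_pow]
    gcongr
    · exact hbρ θ
    · exact hR x hx θ
  · have h := ((hasDerivAt_id x).mul_const (b θ)).const_sub 1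
    refine ((hasDerivAt_const x (a θ)).div h (hne x hx θ)).congr_deriv ?_
    simp only [id]
    ring

/-! ### The bound uniform in `r`. -/

theorem norm_dilatedCauchyAverage_le_of_norm_eq_one (hφ : DifferentiableOn ℂ φ (ball 0 1))
    (hmaps : MapsTo φ (ball 0 1) (ball 0 1)) (hr0 : 0 ≤ r) (hr1 : r < 1) {g : ℂ → ℂ}
    (hg : DiffContOnCl ℂ g (ball 0 1)) {M : ℝ} (hM : ∀ z ∈ closedBall (0 : ℂ) 1, ‖g z‖ ≤ M)
    {ζ : ℂ} (hζ : ‖ζ‖ = 1) :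
    ‖dilatedCauchyAverage φ g r ζ‖ ≤ (1 + 2 * ‖φ 0‖) / (1 - ‖φ 0‖) * M := by
  have hM0 : 0 ≤ M := (norm_nonneg _).trans (hM 0 (by simp))
  have hφ0 : ‖φ 0‖ < 1 := mem_ball_zero_iff.1 (hmaps (by simp))
  have hb : ∀ z ∈ closedBall (0 : ℂ) 1, ‖conj ζ * φ (r * z)‖ < 1 := fun z hz =>
    norm_mul_lt_one_of_le_of_lt (by simp [hζ]) (norm_comp_real_mul_lt_one hmaps hr0 hr1 hz)
  set G : ℂ → ℂ := fun z => (1 - conj ζ * φ (r * z))⁻¹ with hGdef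
  have hG : DiffContOnCl ℂ G (ball 0 1) := by
    refine DiffContOnCl.inv (((diffContOnCl_comp_real_mul hφ hr0 hr1).const_smul
      (conj ζ)).const_sub 1) fun x hx => ?_
    rw [closure_ball 0 one_ne_zero] at hx
    exact one_sub_ne_zero_of_norm_lt_one (hb x hx)
  have hsub : sphere (0 : ℂ) |1| ⊆ closedBall 0 1 := by
    rw [abs_one]; exact sphere_subset_closedBall
  have hGc : ContinuousOn G (sphere 0 |1|) := hG.continuousOn_ball.mono hsub
  have hgc : ContinuousOn g (sphere 0 |1|) := hg.continuousOn_ball.mono hsub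
  have hGi : CircleIntegrable G 0 1 := hGc.circleIntegrable'
  have huc : ContinuousOn (fun z => 2 * (G z).re - 1) (sphere 0 |1|) :=
    (continuousOn_const.mul (Complex.continuous_re.comp_continuousOn hGc)).sub continuousOn_const
  have hmean : Real.circleAverage G 0 1 = G 0 :=
    DiffContOnCl.circleAverage (by simpa using hG)
  have hmean' : Real.circleAverage (fun z => g z * (G z - 1)) 0 1 = g 0 * (G 0 - 1) :=
    DiffContOnCl.circleAverage (by simpa using hg.smul (hG.sub_const 1))
  have hre : Real.circleAverage (fun z => 2 * (G z).re - 1) 0 1 = 2 * (G 0).re - 1 := by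
    have h1 := Complex.reCLM.circleAverage_comp_comm hGi
    rw [hmean] at h1
    have hrei : CircleIntegrable (fun z => 2 * (G z).re) 0 1 :=
      (continuousOn_const.mul (Complex.continuous_re.comp_continuousOn hGc)).circleIntegrable'
    rw [Real.circleAverage_fun_sub hrei (circleIntegrable_const _ _ _),
      Real.circleAverage_const]
    congr 1
    exact (Real.circleAverage_fun_smul (a := (2 : ℝ)) (f := fun z => (G z).re)).trans
      (congrArg (fun x => 2 * x) h1)
  have hupos : ∀ z ∈ sphere (0 : ℂ) |1|, 0 ≤ 2 * (G z).re - 1 := fun z hz => by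
    have := half_le_re_inv_one_sub (hb z (hsub hz))
    simp only [hGdef]
    linarith
  -- From `conj G = 2 Re G - G`: a nonnegative kernel minus an analytic one whose average is known.
  have hsplit : dilatedCauchyAverage φ g r ζ =
      Real.circleAverage (fun z => g z * ((2 * (G z).re - 1 : ℝ) : ℂ)) 0 1 - g 0 * (G 0 - 1) := by
    rw [← hmean', ← Real.circleAverage_fun_sub]
    · refine Real.circleAverage_congr_sphere fun z _ => ?_
      have hconj : (1 - ζ * conj (φ (r * z)))⁻¹ = conj (G z) := by
        simp [hGdef]
      have hadd := Complex.add_conj (G z)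
      simp only [div_eq_mul_inv, hconj]
      push_cast at hadd ⊢
      linear_combination g z * hadd
    · exact (hgc.mul (Complex.continuous_ofReal.comp_continuousOn huc)).circleIntegrable'
    · exact (hgc.mul (hGc.sub continuousOn_const)).circleIntegrable'
  have hmain : ‖Real.circleAverage (fun z => g z * ((2 * (G z).re - 1 : ℝ) : ℂ)) 0 1‖ ≤
      M * (2 * (G 0).re - 1) := by
    rw [← hre, ← smul_eq_mul M, ← Real.circleAverage_fun_smul]
    rw [Real.circleAverage_def, Real.circleAverage_def, norm_smul,
      Real.norm_of_nonneg (by positivity), smul_eq_mul (α := ℝ)]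
    gcongr
    refine intervalIntegral.norm_integral_le_of_norm_le (by positivity)
      (Eventually.of_forall fun θ _ => ?_)
      (ContinuousOn.circleIntegrable' (continuousOn_const.mul huc))
    have hθ := circleMap_mem_sphere' (0 : ℂ) 1 θ
    rw [norm_mul, Complex.norm_real, Real.norm_of_nonneg (hupos _ hθ)]
    exact mul_le_mul_of_nonneg_right (hM _ (hsub hθ)) (hupos _ hθ)
  have hne : 1 - conj ζ * φ 0 ≠ 0 := by
    simpa using one_sub_ne_zero_of_norm_lt_one (hb 0 (by simp))
  have hnorm : ‖conj ζ * φ 0‖ = ‖φ 0‖ := by simp [hζ]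
  have hG0 : ‖G 0‖ ≤ 1 / (1 - ‖φ 0‖) := by
    have := norm_sub_norm_le (1 : ℂ) (conj ζ * φ 0)
    rw [norm_one, hnorm] at this
    simp only [hGdef, mul_zero, norm_inv]
    rw [← one_div]
    exact one_div_le_one_div_of_le (by linarith) this
  have hG1 : ‖G 0 - 1‖ ≤ ‖φ 0‖ / (1 - ‖φ 0‖) := by
    have : G 0 - 1 = conj ζ * φ 0 * G 0 := by
      simp only [hGdef, mul_zero]
      field_simp
      ring
    rw [this, norm_mul, hnorm, div_eq_mul_one_div]
    gcongr
  have hre0 := (Complex.re_le_norm (G 0)).trans hG0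
  calc ‖dilatedCauchyAverage φ g r ζ‖
      ≤ M * (2 * (1 / (1 - ‖φ 0‖)) - 1) + M * (‖φ 0‖ / (1 - ‖φ 0‖)) := by
        rw [hsplit]
        refine (norm_sub_le _ _).trans (add_le_add (hmain.trans ?_) ?_)
        · gcongr
        · rw [norm_mul]
          exact mul_le_mul (hM 0 (by simp)) hG1 (norm_nonneg _) hM0
    _ = (1 + 2 * ‖φ 0‖) / (1 - ‖φ 0‖) * M := by
        have : 1 - ‖φ 0‖ ≠ 0 := by linarith
        field_simp
        ring

/-- The maximum principle in `ζ` carries the bound from the circle to the disk. -/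
theorem norm_dilatedCauchyAverage_le (hφ : DifferentiableOn ℂ φ (ball 0 1))
    (hmaps : MapsTo φ (ball 0 1) (ball 0 1)) (hr0 : 0 ≤ r) (hr1 : r < 1) {g : ℂ → ℂ}
    (hg : DiffContOnCl ℂ g (ball 0 1)) {M : ℝ} (hM : ∀ z ∈ closedBall (0 : ℂ) 1, ‖g z‖ ≤ M)
    {ζ : ℂ} (hζ : ‖ζ‖ ≤ 1) :
    ‖dilatedCauchyAverage φ g r ζ‖ ≤ (1 + 2 * ‖φ 0‖) / (1 - ‖φ 0‖) * M := by
  have hd : DifferentiableOn ℂ (dilatedCauchyAverage φ g r) (closure (ball 0 1)) := fun z hz => by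
    rw [closure_ball 0 one_ne_zero, mem_closedBall_zero_iff] at hz
    exact (differentiableAt_dilatedCauchyAverage hφ hmaps hr0 hr1
      hg.continuousOn_ball hz).differentiableWithinAt
  refine Complex.norm_le_of_forall_mem_frontier_norm_le isBounded_ball hd.diffContOnCl
    (fun z hz => ?_) (z := ζ) ?_
  · rw [frontier_ball 0 one_ne_zero, mem_sphere_zero_iff_norm] at hz
    exact norm_dilatedCauchyAverage_le_of_norm_eq_one hφ hmaps hr0 hr1 hg hM hz
  · rwa [closure_ball 0 one_ne_zero, mem_closedBall_zero_iff]

/-! ### Linearity in the density and the dilation identity. -/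

theorem dilatedCauchyAverage_sub (hφ : DifferentiableOn ℂ φ (ball 0 1))
    (hmaps : MapsTo φ (ball 0 1) (ball 0 1)) (hr0 : 0 ≤ r) (hr1 : r < 1) {f g : ℂ → ℂ}
    (hf : ContinuousOn f (closedBall 0 1)) (hg : ContinuousOn g (closedBall 0 1))
    {ζ : ℂ} (hζ : ‖ζ‖ ≤ 1) :
    dilatedCauchyAverage φ (fun z => f z - g z) r ζ =
      dilatedCauchyAverage φ f r ζ - dilatedCauchyAverage φ g r ζ := by
  unfold dilatedCauchyAverage
  simp only [sub_div]
  exact Real.circleAverage_fun_sub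
    (circleIntegrable_dilatedCauchyKernel hφ hmaps hr0 hr1 hf hζ)
    (circleIntegrable_dilatedCauchyKernel hφ hmaps hr0 hr1 hg hζ)

theorem dilatedCauchyAverage_add (hφ : DifferentiableOn ℂ φ (ball 0 1))
    (hmaps : MapsTo φ (ball 0 1) (ball 0 1)) (hr0 : 0 ≤ r) (hr1 : r < 1) {f g : ℂ → ℂ}
    (hf : ContinuousOn f (closedBall 0 1)) (hg : ContinuousOn g (closedBall 0 1))
    {ζ : ℂ} (hζ : ‖ζ‖ ≤ 1) :
    dilatedCauchyAverage φ (fun z => f z + g z) r ζ =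
      dilatedCauchyAverage φ f r ζ + dilatedCauchyAverage φ g r ζ := by
  unfold dilatedCauchyAverage
  simp only [add_div]
  exact Real.circleAverage_fun_add
    (circleIntegrable_dilatedCauchyKernel hφ hmaps hr0 hr1 hf hζ)
    (circleIntegrable_dilatedCauchyKernel hφ hmaps hr0 hr1 hg hζ)

theorem dilatedCauchyAverage_const_mul (φ g : ℂ → ℂ) (r : ℝ) (c ζ : ℂ) :
    dilatedCauchyAverage φ (fun z => c * g z) r ζ = c * dilatedCauchyAverage φ g r ζ := by
  unfold dilatedCauchyAverage
  simp only [mul_div_assoc]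
  exact Real.circleAverage_fun_smul (a := c)
    (f := fun t : ℂ => g t / (1 - ζ * conj (φ ((r : ℂ) * t))))

/-- Cauchy's theorem for `f z / z` on the annulus; nothing is needed near `0`. -/
theorem circleAverage_eq_of_differentiableOn_annulus {f : ℂ → ℂ} {s : ℝ} (hs0 : 0 < s)
    (hs1 : s ≤ 1) (hc : ContinuousOn f (closedBall 0 1 \ ball 0 s))
    (hd : ∀ z ∈ ball (0 : ℂ) 1 \ closedBall 0 s, DifferentiableAt ℂ f z) :
    Real.circleAverage f 0 1 = Real.circleAverage f 0 s := by
  rw [Real.circleAverage_eq_circleIntegral one_ne_zero,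
    Real.circleAverage_eq_circleIntegral hs0.ne',
    Complex.circleIntegral_sub_center_inv_smul_eq_of_differentiable_on_annulus_off_countable
      hs0 hs1 countable_empty hc (by simpa using hd)]

/-- Dilating the kernel is the same as dilating the density. -/
theorem dilatedCauchyAverage_mul_eq (hφ : DifferentiableOn ℂ φ (ball 0 1))
    (hmaps : MapsTo φ (ball 0 1) (ball 0 1)) (hr0 : 0 ≤ r) (hr1 : r < 1) {s : ℝ} (hs0 : 0 < s)
    (hs1 : s ≤ 1) {g : ℂ → ℂ} (hg : DiffContOnCl ℂ g (ball 0 1)) {ζ : ℂ} (hζ : ‖ζ‖ ≤ 1) :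
    dilatedCauchyAverage φ g (r * s) ζ = dilatedCauchyAverage φ (fun z => g (s * z)) r ζ := by
  set ψ : ℂ → ℂ := fun z => conj (φ (conj z)) with hψdef
  have hψ : ∀ z ∈ ball (0 : ℂ) 1, DifferentiableAt ℂ ψ z := fun z hz => by
    have : DifferentiableAt ℂ φ (conj z) :=
      hφ.differentiableAt (isOpen_ball.mem_nhds (by simpa using hz))
    have h := this.star_star
    rwa [← Complex.star_def, star_star] at h
  have hψ1 : ∀ z ∈ ball (0 : ℂ) 1, ‖ψ z‖ < 1 := fun z hz => by
    have h := hmaps (x := conj z) (by simpa using hz)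
    simpa [hψdef] using h
  -- On the unit circle `conj w = 1 / w`, so this agrees with the integrand there, yet it is
  -- analytic in `w` for `s < ‖w‖ < 1`, where `r s / w` stays in the disk.
  set f : ℂ → ℂ := fun w => g w / (1 - ζ * ψ ((r * s : ℝ) / w)) with hfdef
  have hmem : ∀ w ∈ closedBall (0 : ℂ) 1 \ ball 0 s, w ≠ 0 ∧
      ((r * s : ℝ) / w : ℂ) ∈ ball (0 : ℂ) 1 := by
    rintro w ⟨-, hw⟩
    rw [mem_ball_zero_iff, not_lt] at hw
    have hw0 : 0 < ‖w‖ := hs0.trans_le hw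
    refine ⟨norm_pos_iff.1 hw0, ?_⟩
    rw [mem_ball_zero_iff, norm_div, Complex.norm_real, Real.norm_of_nonneg (by positivity),
      div_lt_one hw0]
    nlinarith
  have hk : ∀ w ∈ closedBall (0 : ℂ) 1 \ ball 0 s,
      DifferentiableAt ℂ (fun w => 1 - ζ * ψ ((r * s : ℝ) / w)) w ∧
        1 - ζ * ψ ((r * s : ℝ) / w) ≠ 0 := fun w hw => by
    obtain ⟨hw0, hwm⟩ := hmem w hw
    refine ⟨?_, one_sub_ne_zero_of_norm_lt_one (norm_mul_lt_one_of_le_of_lt hζ (hψ1 _ hwm))⟩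
    have h1 : DifferentiableAt ℂ (fun w : ℂ => ((r * s : ℝ) : ℂ) / w) w :=
      (differentiableAt_const _).div differentiableAt_id hw0
    exact ((DifferentiableAt.comp w (hψ _ hwm) h1).const_mul ζ).const_sub 1
  have hannulus : Real.circleAverage f 0 1 = Real.circleAverage f 0 s := by
    refine circleAverage_eq_of_differentiableOn_annulus hs0 hs1 ?_ ?_
    · exact (hg.continuousOn_ball.mono sdiff_subset).div
        (fun w hw => (hk w hw).1.continuousAt.continuousWithinAt) fun w hw => (hk w hw).2
    · intro w hw
      have hw' := hk w ⟨ball_subset_closedBall hw.1, fun h => hw.2 (ball_subset_closedBall h)⟩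
      exact (hg.differentiableAt isOpen_ball hw.1).div hw'.1 hw'.2
  have hinv : ∀ t ∈ sphere (0 : ℂ) |1|, t ≠ 0 ∧ conj t⁻¹ = t := fun t ht => by
    have ht' : ‖t‖ = 1 := by simpa using ht
    exact ⟨norm_pos_iff.1 (by simp [ht']), by rw [Complex.inv_eq_conj ht', Complex.conj_conj]⟩
  have h1 : dilatedCauchyAverage φ g (r * s) ζ = Real.circleAverage f 0 1 := by
    refine Real.circleAverage_congr_sphere fun t ht => ?_
    simp only [hfdef, hψdef, div_eq_mul_inv _ t, map_mul, Complex.conj_ofReal, (hinv t ht).2]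
  have h2 : Real.circleAverage f 0 s = dilatedCauchyAverage φ (fun z => g (s * z)) r ζ := by
    rw [Real.circleAverage_eq_circleAverage_zero_one]
    refine Real.circleAverage_congr_sphere fun t ht => ?_
    have hs : (s : ℂ) ≠ 0 := by exact_mod_cast hs0.ne'
    have : ((r * s : ℝ) / (s * t) : ℂ) = r * t⁻¹ := by
      have := (hinv t ht).1
      push_cast
      field_simp
    simp only [hfdef, hψdef, add_zero, this, map_mul, Complex.conj_ofReal, (hinv t ht).2]
  rw [h1, hannulus, h2]

theorem diffContOnCl_comp_real_mul_of_le_one {g : ℂ → ℂ} (hg : DiffContOnCl ℂ g (ball 0 1))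
    {s : ℝ} (hs0 : 0 ≤ s) (hs1 : s ≤ 1) : DiffContOnCl ℂ (fun z : ℂ => g (s * z)) (ball 0 1) := by
  refine hg.comp (Differentiable.diffContOnCl (by fun_prop)) fun z hz => ?_
  simp only [mem_ball_zero_iff, norm_mul, Complex.norm_real, Real.norm_of_nonneg hs0] at *
  nlinarith [norm_nonneg z]

/-! ### Uniform convergence as `r → 1`. -/

theorem exists_norm_dilatedCauchyAverage_sub_le (hφ : DifferentiableOn ℂ φ (ball 0 1))
    (hmaps : MapsTo φ (ball 0 1) (ball 0 1)) {g : ℂ → ℂ} (hg : DiffContOnCl ℂ g (ball 0 1))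
    {ε : ℝ} (hε : 0 < ε) :
    ∃ r₀ < 1, ∀ r ∈ Ioo r₀ 1, ∀ r' ∈ Ioo r₀ 1, ∀ ζ ∈ closedBall (0 : ℂ) 1,
      ‖dilatedCauchyAverage φ g r ζ - dilatedCauchyAverage φ g r' ζ‖ ≤
        (1 + 2 * ‖φ 0‖) / (1 - ‖φ 0‖) * ε := by
  obtain ⟨δ, hδ, hgδ⟩ := Metric.uniformContinuousOn_iff.1
    ((isCompact_closedBall (0 : ℂ) 1).uniformContinuousOn_of_continuous hg.continuousOn_ball) ε hε
  -- With `r > 1/2` and `r - r' < δ / 2`, the dilation factor satisfies `1 - r' / r < δ`.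
  refine ⟨1 - min (1 / 2) (δ / 2), by simp [hδ], ?_⟩
  have key : ∀ r ∈ Ioo (1 - min (1 / 2) (δ / 2)) 1, ∀ r' ∈ Ioo (1 - min (1 / 2) (δ / 2)) 1,
      r' ≤ r → ∀ ζ ∈ closedBall (0 : ℂ) 1,
      ‖dilatedCauchyAverage φ g r ζ - dilatedCauchyAverage φ g r' ζ‖ ≤
        (1 + 2 * ‖φ 0‖) / (1 - ‖φ 0‖) * ε := by
    intro r hr r' hr' hle ζ hζ
    have hm1 := min_le_left (1 / 2) (δ / 2)
    have hm2 := min_le_right (1 / 2) (δ / 2)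
    have hr0 : 1 / 2 < r := by linarith [hr.1]
    have hr0' : 1 / 2 < r' := by linarith [hr'.1]
    have hs0 : 0 < r' / r := by positivity
    have hs1 : r' / r ≤ 1 := (div_le_one (by linarith)).2 hle
    have hζ' := mem_closedBall_zero_iff.1 hζ
    have hgs := diffContOnCl_comp_real_mul_of_le_one hg hs0.le hs1
    have hrr : r' = r * (r' / r) := by field_simp
    nth_rewrite 1 [hrr]
    rw [dilatedCauchyAverage_mul_eq hφ hmaps (by linarith) hr.2 hs0 hs1 hg hζ',
      ← dilatedCauchyAverage_sub hφ hmaps (by linarith) hr.2 hg.continuousOn_ball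
        hgs.continuousOn_ball hζ']
    refine norm_dilatedCauchyAverage_le hφ hmaps (by linarith) hr.2 (hg.sub hgs)
      (fun z hz => ?_) hζ'
    rw [Pi.sub_apply, ← dist_eq_norm]
    refine (hgδ z hz _ (mapsTo_real_mul_closedBall_self hs0.le hs1 hz) ?_).le
    have hz' := mem_closedBall_zero_iff.1 hz
    have : z - ((r' / r : ℝ) : ℂ) * z = ((1 - r' / r : ℝ) : ℂ) * z := by push_cast; ring
    rw [dist_eq_norm, this, norm_mul, Complex.norm_real, Real.norm_of_nonneg (by linarith)]
    have hlt : 1 - r' / r < δ := by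
      rw [sub_lt_comm, lt_div_iff₀ (by linarith)]
      nlinarith [hr.2, hr'.1, hr.1]
    nlinarith [norm_nonneg z]
  intro r hr r' hr' ζ hζ
  rcases le_total r' r with h | h
  · exact key r hr r' hr' h ζ hζ
  · rw [norm_sub_rev]
    exact key r' hr' r hr h ζ hζ

theorem exists_tendstoUniformlyOn_dilatedCauchyAverage (hφ : DifferentiableOn ℂ φ (ball 0 1))
    (hmaps : MapsTo φ (ball 0 1) (ball 0 1)) {g : ℂ → ℂ} (hg : DiffContOnCl ℂ g (ball 0 1)) :
    ∃ L : ℂ → ℂ,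
      TendstoUniformlyOn (dilatedCauchyAverage φ g) L (𝓝[<] (1 : ℝ)) (closedBall 0 1) := by
  have hC : 0 < (1 + 2 * ‖φ 0‖) / (1 - ‖φ 0‖) := by
    have : ‖φ 0‖ < 1 := mem_ball_zero_iff.1 (hmaps (by simp))
    exact div_pos (by positivity) (by linarith)
  have hcau : UniformCauchySeqOn (dilatedCauchyAverage φ g) (𝓝[<] (1 : ℝ)) (closedBall 0 1) := by
    intro u hu
    obtain ⟨ε, hε, hεu⟩ := Metric.mem_uniformity_dist.1 hu
    obtain ⟨r₀, hr₀, h⟩ := exists_norm_dilatedCauchyAverage_sub_le hφ hmaps hg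
      (ε := ε / 2 / ((1 + 2 * ‖φ 0‖) / (1 - ‖φ 0‖))) (by positivity)
    filter_upwards [prod_mem_prod (Ioo_mem_nhdsLT hr₀) (Ioo_mem_nhdsLT hr₀)] with p hp ζ hζ
    refine hεu ?_
    have := h p.1 hp.1 p.2 hp.2 ζ hζ
    rw [mul_div_cancel₀ _ hC.ne'] at this
    rw [dist_eq_norm]
    linarith
  have hlim : ∀ ζ, ∃ l, ζ ∈ closedBall (0 : ℂ) 1 →
      Tendsto (fun r => dilatedCauchyAverage φ g r ζ) (𝓝[<] (1 : ℝ)) (𝓝 l) := fun ζ => by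
    by_cases hζ : ζ ∈ closedBall (0 : ℂ) 1
    · obtain ⟨l, hl⟩ := cauchy_iff_exists_le_nhds.1 (hcau.cauchy_map hζ)
      exact ⟨l, fun _ => hl⟩
    · exact ⟨0, fun h => absurd h hζ⟩
  choose L hL using hlim
  exact ⟨L, hcau.tendstoUniformlyOn_of_tendsto hL⟩

end SelfMap

/-! ### Passage to the disk algebra. -/

theorem diffContOnCl_zeroExtend (h : DiskAlgebra) :
    DiffContOnCl ℂ (zeroExtend (h : C(ClosedUnitDisk, ℂ))) (ball 0 1) := by
  have hd : AnalyticOnNhd ℂ (zeroExtend (h : C(ClosedUnitDisk, ℂ))) (ball 0 1) := h.2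
  refine DiffContOnCl.mk_ball hd.differentiableOn ?_
  rw [continuousOn_iff_continuous_domRestrict]
  refine (h : C(ClosedUnitDisk, ℂ)).continuous.congr fun z => ?_
  exact (zeroExtend_of_mem _ z.2).symm

theorem norm_zeroExtend_le (h : DiskAlgebra) {z : ℂ} (hz : z ∈ closedBall (0 : ℂ) 1) :
    ‖zeroExtend (h : C(ClosedUnitDisk, ℂ)) z‖ ≤ ‖h‖ := by
  rw [zeroExtend_of_mem _ hz]
  exact (h : C(ClosedUnitDisk, ℂ)).norm_coe_le_norm _

theorem exists_diskAlgebra_tendsto_cauchyKernelIntegral {φ : ℂ → ℂ}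
    (hφ : DifferentiableOn ℂ φ (ball 0 1)) (hmaps : MapsTo φ (ball 0 1) (ball 0 1))
    (h : DiskAlgebra) :
    ∃ F : DiskAlgebra, ∀ ζ : ClosedUnitDisk,
      Tendsto (fun r : ℝ => cauchyKernelIntegral φ h r (ζ : ℂ)) (𝓝[<] (1 : ℝ))
        (𝓝 ((F : C(ClosedUnitDisk, ℂ)) ζ)) := by
  obtain ⟨L, hL⟩ := exists_tendstoUniformlyOn_dilatedCauchyAverage hφ hmaps
    (diffContOnCl_zeroExtend h)
  have hdiff : ∀ᶠ r in 𝓝[<] (1 : ℝ), DifferentiableOn ℂ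
      (dilatedCauchyAverage φ (zeroExtend (h : C(ClosedUnitDisk, ℂ))) r) (closedBall 0 1) := by
    filter_upwards [Ioo_mem_nhdsLT zero_lt_one] with r hr ζ hζ
    exact (differentiableAt_dilatedCauchyAverage hφ hmaps hr.1.le hr.2
      (diffContOnCl_zeroExtend h).continuousOn_ball
      (mem_closedBall_zero_iff.1 hζ)).differentiableWithinAt
  have hcont : ContinuousOn L (closedBall 0 1) :=
    hL.continuousOn (hdiff.mono fun _ => DifferentiableOn.continuousOn).frequently
  have hLd : DifferentiableOn ℂ L (ball 0 1) :=
    (hL.mono ball_subset_closedBall).tendstoLocallyUniformlyOn.differentiableOn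
      (hdiff.mono fun _ hr => hr.mono ball_subset_closedBall) isOpen_ball
  let F : C(ClosedUnitDisk, ℂ) := ⟨fun ζ => L ζ, continuousOn_iff_continuous_domRestrict.1 hcont⟩
  have hF : F ∈ DiskAlgebra := by
    refine (hLd.analyticOnNhd isOpen_ball).congr isOpen_ball fun z hz => ?_
    rw [zeroExtend_of_mem _ (ball_subset_closedBall hz)]
    rfl
  exact ⟨⟨F, hF⟩, fun ζ => hL.tendsto_at ζ.2⟩

theorem mainTheorem3 (φ : ℂ → ℂ) (hφ : AnalyticOnNhd ℂ φ (Metric.ball 0 1))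
    (hmaps : Set.MapsTo φ (Metric.ball 0 1) (Metric.ball 0 1)) :
    ∃ P : DiskAlgebra →L[ℂ] DiskAlgebra,
      (∀ (h : DiskAlgebra) (ζ : ClosedUnitDisk),
        Filter.Tendsto (fun r : ℝ => cauchyKernelIntegral φ h r (ζ : ℂ)) (𝓝[<] (1 : ℝ))
          (𝓝 ((P h : C(ClosedUnitDisk, ℂ)) ζ))) ∧
      ‖P‖ ≤ (1 + 2 * ‖φ 0‖) / (1 - ‖φ 0‖) := by
  have hd := hφ.differentiableOn
  have hC : 0 ≤ (1 + 2 * ‖φ 0‖) / (1 - ‖φ 0‖) := by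
    have : ‖φ 0‖ < 1 := mem_ball_zero_iff.1 (hmaps (by simp))
    exact div_nonneg (by positivity) (by linarith)
  have hev : ∀ᶠ r in 𝓝[<] (1 : ℝ), r ∈ Ioo (0 : ℝ) 1 := Ioo_mem_nhdsLT zero_lt_one
  choose P hP using exists_diskAlgebra_tendsto_cauchyKernelIntegral hd hmaps
  let T : DiskAlgebra →ₗ[ℂ] DiskAlgebra :=
    { toFun := P
      map_add' := fun f g => by
        refine Subtype.ext (ContinuousMap.ext fun ζ => ?_)
        refine tendsto_nhds_unique (hP (f + g) ζ) (((hP f ζ).add (hP g ζ)).congr' ?_)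
        filter_upwards [hev] with r hr
        refine (dilatedCauchyAverage_add hd hmaps hr.1.le hr.2
          (diffContOnCl_zeroExtend f).continuousOn_ball
          (diffContOnCl_zeroExtend g).continuousOn_ball
          (mem_closedBall_zero_iff.1 ζ.2)).symm.trans ?_
        refine Real.circleAverage_congr_sphere fun t ht => ?_
        have ht' : t ∈ ClosedUnitDisk := sphere_subset_closedBall (by simpa using ht)
        simp [zeroExtend_of_mem _ ht']
      map_smul' := fun c f => by
        refine Subtype.ext (ContinuousMap.ext fun ζ => ?_)
        refine tendsto_nhds_unique (hP (c • f) ζ) (((hP f ζ).const_mul c).congr fun r => ?_)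
        refine (dilatedCauchyAverage_const_mul φ _ r c ζ).symm.trans ?_
        refine Real.circleAverage_congr_sphere fun t ht => ?_
        have ht' : t ∈ ClosedUnitDisk := sphere_subset_closedBall (by simpa using ht)
        simp [zeroExtend_of_mem _ ht'] }
  -- The bound holds for each `r` in `(0, 1)` and survives the pointwise limit.
  refine ⟨T.mkContinuous _ fun h => ?_, hP, T.mkContinuous_norm_le hC _⟩
  refine (ContinuousMap.norm_le _ (by positivity)).2 fun ζ => ?_
  refine le_of_tendsto (hP h ζ).norm ?_
  filter_upwards [hev] with r hr
  exact norm_dilatedCauchyAverage_le hd hmaps hr.1.le hr.2 (diffContOnCl_zeroExtend h)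
    (fun z hz => norm_zeroExtend_le h hz) (mem_closedBall_zero_iff.1 ζ.2)
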